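/- **Setting.** Let $P_\infty(x)=1-\cos(2\pi x)$ and let $Z_\infty$ be the planar piecewise smooth vector field given by $X^+_\infty(x,y)=(1,P_\infty'(x))=(1,2\pi\sin 2\pi x)$ on $\Sigma^+=\{y\ge 0\}$ and $X^-_\infty(x,y)=(-1,P_\infty'(x))=(-1,2\pi\sin 2\pi x)$ on $\Sigma^-=\{y\le 0\}$. A positive global trajectory of $Z_\infty$ is a curve $\gamma:[0,\infty)\to\mathbb R^2$ which is a concatenation of orbit pieces of $X^+_\infty$ in $\Sigma^+$, of orbit pieces of $X^-_\infty$ in $\Sigma^-$, and of constant pieces at invisible-invisible tangencies. Let $\Omega_\infty$ be the set of positive global trajectories with $\gamma(0)\in\Lambda_\infty=\{y=P_\infty(x)\}\cup\{y=-P_\infty(x)\}$. For $j\in\mathbb Z$ put $I_{2j}=\{(x,P_\infty(x)):j<x<j+1\}$ and $I_{2j+1}=\{(x,-P_\infty(x)):j<x<j+1\}$. The itinerary of $\gamma\in\Omega_\infty$ is $(s_i(\gamma))_{i\ge0}$, where $s_i(\gamma)=n$ if $\gamma(i)\in I_n$, or if $\gamma(i)\in\mathbb Z\times\{0\}$ and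 $\gamma(i+\frac12)\in I_n$. Let $\mathcal G^{Z_\infty}$ be the directed graph with vertex set $\mathbb Z$ (the indices of the arcs $I_n$) and an edge $a\to b$ whenever $s_i(\gamma)=a$, $s_{i+1}(\gamma)=b$ for some $\gamma\in\Omega_\infty$ and $i\ge 0$. Let $\mathcal H$ be a subgraph of $\mathcal G^{Z_\infty}$ (possibly $\mathcal G^{Z_\infty}$ itself) with infinite vertex set $V\subseteq\mathbb Z$, and let $X=\{(x_i)_{i\ge0}\in V^{\mathbb N}: x_i\to x_{i+1}\text{ in }\mathcal H\text{ for all }i\}$ be its one-sided Markov shift, with shift map $\sigma$ and metric $d(x,y)=\sum_{i\ge 0}|x_i-y_i|/2^i$. The shift is topologically transitive if for all $a,b\in V$ there is a path of some length $n\ge1$ from $a$ to $b$ in $\mathcal H$. * *Entropy at infinity.* Label the vertices by natural numbers $e(a)$ so that $\{a\in V:e(a)\le q\}$ is finite for every $q$ (for instance by an enumeration of $V$). Let $z_n(M,q)$ be the number of nonempty cylinders $[a_0,\dots,a_{n+1}]$ of $X$ with $e(a_0)\le q$, $e(a_{n+1})\le q$ and $\#\{0\le i\le n+1: e(a_i)\le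 q\}\le (n+2)/M$. With $\log 0=-\infty$, put $h_\infty(M,q)=\limsup_{n\to\infty}\frac1n\log z_n(M,q)$, $h_\infty(q)=\liminf_{M\to\infty}h_\infty(M,q)$ and $h_\infty=\liminf_{q\to\infty}h_\infty(q)$. * *Escape on average.* $E$ is the set of $x\in X$ such that $\lim_{n\to\infty}\frac1n\sum_{i=0}^{n-1}\mathbf 1_{[a]}(\sigma^i x)=0$ for every $a\in V$. * *Recurrence.* $\mathcal R$ is the set of $x\in X$ for which there is a strictly increasing sequence $(n_k)$ with $\sigma^{n_k}x\to x$. **Theorem.** If $X$ is topologically transitive and $h_\infty<\infty$, then $$\dim_H(E\cap\mathcal R)\le\frac{h_\infty}{\log 2},$$ where $\dim_H$ is the Hausdorff dimension with respect to $d$. -/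

import Mathlib

open Set Filter Topology
open scoped ENNReal

noncomputable section

/-! ### Planar piecewise smooth vector fields -/

/-- The data of a planar piecewise smooth vector field: a switching function `f`, a field `Xp`
followed on `{f ≥ 0}` and a field `Xm` followed on `{f ≤ 0}`. -/
structure PlanarPSVF where
  f : ℝ × ℝ → ℝ
  Xp : ℝ × ℝ → ℝ × ℝ
  Xm : ℝ × ℝ → ℝ × ℝ

/-- `Σ⁺`. -/
def PlanarPSVF.regionPos (Z : PlanarPSVF) : Set (ℝ × ℝ) := {q | 0 ≤ Z.f q}

/-- `Σ⁻`. -/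
def PlanarPSVF.regionNeg (Z : PlanarPSVF) : Set (ℝ × ℝ) := {q | Z.f q ≤ 0}

/-- On the time interval `[s, t]` the curve `c` lies in `S` and is an orbit of the field `X`. -/
def IsOrbitIn (X : ℝ × ℝ → ℝ × ℝ) (S : Set (ℝ × ℝ)) (c : ℝ → ℝ × ℝ) (s t : ℝ) : Prop :=
  ∀ u ∈ Icc s t, c u ∈ S ∧ HasDerivWithinAt c (X (c u)) (Icc s t) u

/-- The Lie derivative `X f (q)`. -/
def lieDeriv (X : ℝ × ℝ → ℝ × ℝ) (f : ℝ × ℝ → ℝ) (q : ℝ × ℝ) : ℝ := fderiv ℝ f q (X q)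

/-- An orbit of `X` restricted to `S` reaches `p` and continues in `S`. -/
def IsVisibleAt (X : ℝ × ℝ → ℝ × ℝ) (S : Set (ℝ × ℝ)) (p : ℝ × ℝ) : Prop :=
  ∃ ε > 0, ∃ c : ℝ → ℝ × ℝ, c 0 = p ∧ IsOrbitIn X S c (-ε) ε

/-- `p` is a singular (invisible-invisible) tangency. -/
def PlanarPSVF.IsSingularTangency (Z : PlanarPSVF) (p : ℝ × ℝ) : Prop :=
  Z.f p = 0 ∧ lieDeriv Z.Xp Z.f p = 0 ∧ lieDeriv Z.Xm Z.f p = 0 ∧ Z.Xp p ≠ 0 ∧ Z.Xm p ≠ 0 ∧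
    ¬ IsVisibleAt Z.Xp Z.regionPos p ∧ ¬ IsVisibleAt Z.Xm Z.regionNeg p

/-- `γ`, looked at for times `t ≥ 0`, is a positive global trajectory: a concatenation of pieces
each of which is an orbit of `Xp` in `Σ⁺`, an orbit of `Xm` in `Σ⁻`, or the rest at a singular
tangency. -/
def PlanarPSVF.IsPositiveGlobalTrajectory (Z : PlanarPSVF) (γ : ℝ → ℝ × ℝ) : Prop :=
  ∃ τ : ℕ → ℝ, τ 0 = 0 ∧ StrictMono τ ∧ Tendsto τ atTop atTop ∧
    ∀ k : ℕ, IsOrbitIn Z.Xp Z.regionPos γ (τ k) (τ (k + 1)) ∨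
      IsOrbitIn Z.Xm Z.regionNeg γ (τ k) (τ (k + 1)) ∨
      ∃ p, Z.IsSingularTangency p ∧ ∀ u ∈ Icc (τ k) (τ (k + 1)), γ u = p

/-! ### The field `Z_∞`, its arcs and its transition graph -/

/-- `P_∞ (x) = 1 - cos (2 π x)`. -/
def PInf (x : ℝ) : ℝ := 1 - Real.cos (2 * Real.pi * x)

/-- `Z_∞`, with `X^± (x, y) = (± 1, P_∞' (x))` on `± y ≥ 0`. -/
def ZInf : PlanarPSVF where
  f := fun q => q.2
  Xp := fun q => (1, 2 * Real.pi * Real.sin (2 * Real.pi * q.1))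
  Xm := fun q => (-1, 2 * Real.pi * Real.sin (2 * Real.pi * q.1))

/-- `Λ_∞`, the union of the graphs of `P_∞` and `-P_∞`. -/
def LambdaInf : Set (ℝ × ℝ) := {q | q.2 = PInf q.1 ∨ q.2 = -PInf q.1}

/-- `Ω_∞`: the positive global trajectories of `Z_∞` that start in `Λ_∞`. -/
def OmegaInf : Set (ℝ → ℝ × ℝ) := {γ | ZInf.IsPositiveGlobalTrajectory γ ∧ γ 0 ∈ LambdaInf}

/-- The arc `I_n`: for `n = 2 j` the part of the graph of `P_∞` over `(j, j + 1)`, for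
`n = 2 j + 1` the part of the graph of `-P_∞` over `(j, j + 1)`. -/
def arcInf (n : ℤ) : Set (ℝ × ℝ) :=
  {q | ∃ j : ℤ, (j : ℝ) < q.1 ∧ q.1 < j + 1 ∧
    ((n = 2 * j ∧ q.2 = PInf q.1) ∨ (n = 2 * j + 1 ∧ q.2 = -PInf q.1))}

/-- The visible-visible two-folds `(j, 0)` of `Z_∞`. -/
def twoFolds : Set (ℝ × ℝ) := range fun j : ℤ => ((j : ℝ), (0 : ℝ))

/-- `s_j (γ) = n`: the `j`-th entry of the itinerary of `γ` is `n`. -/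
def ItineraryAt (γ : ℝ → ℝ × ℝ) (j : ℕ) (n : ℤ) : Prop :=
  γ j ∈ arcInf n ∨ (γ j ∈ twoFolds ∧ γ (j + 1 / 2) ∈ arcInf n)

/-- A directed graph whose vertices are integers (here: the indices of the arcs `I_n`). -/
structure ArcGraph where
  verts : Set ℤ
  Adj : ℤ → ℤ → Prop
  left_mem : ∀ {a b}, Adj a b → a ∈ verts
  right_mem : ∀ {a b}, Adj a b → b ∈ verts

/-- The graph of `Z_∞`: its vertices are the arcs, its edges are the transitions from one arc to
the next one that occur along the trajectories in `Ω_∞`. -/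
def graphZInf : ArcGraph where
  verts := univ
  Adj a b := ∃ γ ∈ OmegaInf, ∃ j : ℕ, ItineraryAt γ j a ∧ ItineraryAt γ (j + 1) b
  left_mem _ := mem_univ _
  right_mem _ := mem_univ _

/-- `H` is a subgraph of `G`. -/
def ArcGraph.IsSubgraph (H G : ArcGraph) : Prop :=
  H.verts ⊆ G.verts ∧ ∀ a b, H.Adj a b → G.Adj a b

/-- For all vertices `a`, `b` there is a path of some length `n ≥ 1` from `a` to `b`. -/
def ArcGraph.IsTransitive (H : ArcGraph) : Prop :=
  ∀ a ∈ H.verts, ∀ b ∈ H.verts, Relation.TransGen H.Adj a b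

/-! ### The Markov shift -/

/-- The one-sided topological Markov shift of the graph `H`. -/
def MarkovShift (H : ArcGraph) : Type := {x : ℕ → ℤ // ∀ i, H.Adj (x i) (x (i + 1))}

namespace MarkovShift

variable {H : ArcGraph}

/-- The `i`-th letter of `x`. -/
def letter (x : MarkovShift H) (i : ℕ) : ℤ := x.1 i

/-- The shift map. -/
def shift (x : MarkovShift H) : MarkovShift H := ⟨fun i => x.1 (i + 1), fun i => x.2 (i + 1)⟩

/-- The metric `d (a, b) = ∑ i, |a i - b i| / 2 ^ i`, as an extended metric (for subgraphs of
`graphZInf`, neighbouring letters differ by at most `2`, so that all distances are finite). -/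
instance : EMetricSpace (MarkovShift H) where
  edist x y := ∑' i : ℕ, ENNReal.ofReal (|(x.letter i : ℝ) - y.letter i| / 2 ^ i)
  edist_self x := by simp
  edist_comm x y := by simp only [abs_sub_comm]
  edist_triangle x y z := by
    rw [← ENNReal.tsum_add]
    refine ENNReal.tsum_le_tsum fun i => ?_
    rw [← ENNReal.ofReal_add (by positivity) (by positivity), ← add_div]
    refine ENNReal.ofReal_le_ofReal ?_
    gcongr
    exact abs_sub_le _ _ _
  eq_of_edist_eq_zero {x y} h := by
    refine Subtype.ext (funext fun i => ?_)
    have h1 := (ENNReal.tsum_eq_zero.1 h) i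
    rw [ENNReal.ofReal_eq_zero] at h1
    have h2 : |(x.letter i : ℝ) - y.letter i| ≤ 0 := by
      by_contra hc
      push Not at hc
      exact absurd h1 (not_le.2 (by positivity))
    have h3 : (x.letter i : ℝ) = y.letter i :=
      sub_eq_zero.1 (abs_eq_zero.1 (le_antisymm h2 (abs_nonneg _)))
    exact_mod_cast h3

/-- The cylinder `[w 0, …, w (k - 1)]`. -/
def cylinder (H : ArcGraph) {k : ℕ} (w : Fin k → ℤ) : Set (MarkovShift H) :=
  {x | ∀ i : Fin k, x.letter i = w i}

/-- The points of the shift that escape on average: every letter has frequency zero. -/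
def escapeOnAverage (H : ArcGraph) : Set (MarkovShift H) :=
  {x | ∀ a ∈ H.verts, Tendsto
    (fun n : ℕ => (1 / (n : ℝ)) * ∑ i ∈ Finset.range n,
      (cylinder H ![a]).indicator (fun _ => (1 : ℝ)) (shift^[i] x)) atTop (𝓝 0)}

/-- The recurrent points of the shift. -/
def recurrentPoints (H : ArcGraph) : Set (MarkovShift H) :=
  {x | ∃ n : ℕ → ℕ, StrictMono n ∧ Tendsto (fun k => shift^[n k] x) atTop (𝓝 x)}

/-! ### Topological entropy at infinity

`e a` is the natural number by which the letter `a` is labelled. -/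

/-- `z_n (M, q)`: the number of nonempty cylinders `[a_0, …, a_{n+1}]` with `a_0` and `a_{n+1}`
labelled at most `q` and at most `(n + 2) / M` letters labelled at most `q`. -/
def zCount (H : ArcGraph) (e : ℤ → ℕ) (M q n : ℕ) : ℕ∞ :=
  Set.encard {w : Fin (n + 2) → ℤ | (cylinder H w).Nonempty ∧ e (w 0) ≤ q ∧
    e (w (Fin.last (n + 1))) ≤ q ∧
    ((Finset.univ.filter fun i => e (w i) ≤ q).card : ℝ) ≤ ((n : ℝ) + 2) / M}

/-- `h_∞ (M, q) = limsup_n (1 / n) log z_n (M, q)`, where `log 0 = -∞`. -/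
def hInfMq (H : ArcGraph) (e : ℤ → ℕ) (M q : ℕ) : EReal :=
  limsup (fun n : ℕ => ENNReal.log (zCount H e M q n : ℝ≥0∞) / (n : EReal)) atTop

/-- `h_∞ (q) = liminf_M h_∞ (M, q)`. -/
def hInfq (H : ArcGraph) (e : ℤ → ℕ) (q : ℕ) : EReal :=
  liminf (fun M : ℕ => hInfMq H e M q) atTop

/-- The topological entropy at infinity `h_∞ = liminf_q h_∞ (q)`. -/
def hInf (H : ArcGraph) (e : ℤ → ℕ) : EReal :=
  liminf (fun q : ℕ => hInfq H e q) atTop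

end MarkovShift

end

/-! Fix `q` and `M ≥ 1`, and call a letter small if its label is at most `q`. A point of `E ∩ R`
with small first letter returns to that letter infinitely often, and its fraction of small letters
eventually drops below `1 / M`. Hence infinitely many of its initial words are counted by `zCount`
(`exists_mem_countedWords`).

Trajectories have horizontal speed at most one, so neighbouring letters are boundedly close and a
cylinder of length `m + 1` has diameter `O(2 ^ (-m))`. Covering by counted cylinders bounds the
`s`-dimensional measure by a multiple of `∑ z_n 2 ^ (-s n)`, finite once `s log 2 > h_∞ (M, q)`. The
sets grow with `q` and exhaust `E ∩ R`, so the bound survives both lower limits and a countable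
union.

Dimensions are nonnegative, so `h_∞ (M, q) ≥ 0` is needed as well: long excursions to far vertices
supply counted words. -/

/-! ### Trajectories move horizontally with speed at most one -/

lemma IsOrbitIn.abs_fst_sub_le {X : ℝ × ℝ → ℝ × ℝ} {S : Set (ℝ × ℝ)} {c : ℝ → ℝ × ℝ} {s t : ℝ}
    (h : IsOrbitIn X S c s t) (hX : ∀ q, |(X q).1| ≤ 1) {u v : ℝ} (hu : u ∈ Icc s t)
    (hv : v ∈ Icc s t) : |(c v).1 - (c u).1| ≤ |v - u| := by
  have hd : ∀ w ∈ Icc s t, HasDerivWithinAt (fun r => (c r).1) (X (c w)).1 (Icc s t) w :=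
    fun w hw => (h w hw).2.fst
  simpa using Convex.norm_image_sub_le_of_norm_hasDerivWithin_le hd
    (fun w _ => hX (c w)) (convex_Icc s t) hu hv

lemma abs_ZInf_Xp_fst_le (q : ℝ × ℝ) : |(ZInf.Xp q).1| ≤ 1 := by simp [ZInf]

lemma abs_ZInf_Xm_fst_le (q : ℝ × ℝ) : |(ZInf.Xm q).1| ≤ 1 := by simp [ZInf]

lemma abs_fst_sub_le_of_trajectory {γ : ℝ → ℝ × ℝ} (hγ : ZInf.IsPositiveGlobalTrajectory γ)
    {s t : ℝ} (hs : 0 ≤ s) (hst : s ≤ t) : |(γ t).1 - (γ s).1| ≤ t - s := by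
  obtain ⟨τ, h0, hmono, htop, hpiece⟩ := hγ
  have piece : ∀ k, ∀ u v, u ∈ Icc (τ k) (τ (k + 1)) → v ∈ Icc (τ k) (τ (k + 1)) → u ≤ v →
      |(γ v).1 - (γ u).1| ≤ v - u := by
    intro k u v hu hv huv
    rw [← abs_of_nonneg (sub_nonneg.2 huv)]
    rcases hpiece k with h | h | ⟨p, -, h⟩
    · exact h.abs_fst_sub_le abs_ZInf_Xp_fst_le hu hv
    · exact h.abs_fst_sub_le abs_ZInf_Xm_fst_le hu hv
    · simp [h u hu, h v hv]
  have main : ∀ k, ∀ s t, 0 ≤ s → s ≤ t → t ≤ τ k → |(γ t).1 - (γ s).1| ≤ t - s := by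
    intro k
    induction k with
    | zero =>
      intro s t hs hst ht
      have : s = t := by linarith
      simp [this]
    | succ k ih =>
      intro s t hs hst ht
      rcases le_total t (τ k) with h | h
      · exact ih s t hs hst h
      rcases le_total (τ k) s with h' | h'
      · exact piece k s t ⟨h', hst.trans ht⟩ ⟨h, ht⟩ hst
      · have h1 := ih s (τ k) hs h' le_rfl
        have h2 := piece k (τ k) t ⟨le_rfl, h.trans ht⟩ ⟨h, ht⟩ h
        have h3 := abs_sub_le (γ t).1 (γ (τ k)).1 (γ s).1
        linarith
  obtain ⟨k, hk⟩ := (htop.eventually_ge_atTop t).exists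
  exact main k s t hs hst hk

lemma abs_sub_two_mul_fst_le {n : ℤ} {q : ℝ × ℝ} (h : q ∈ arcInf n) :
    |(n : ℝ) - 2 * q.1| ≤ 2 := by
  obtain ⟨j, h1, h2, h3⟩ := h
  rw [abs_le]
  rcases h3 with ⟨rfl, -⟩ | ⟨rfl, -⟩ <;> push_cast <;> constructor <;> linarith

lemma ItineraryAt.exists_time {γ : ℝ → ℝ × ℝ} {j : ℕ} {n : ℤ} (h : ItineraryAt γ j n) :
    ∃ t : ℝ, (j : ℝ) ≤ t ∧ t ≤ j + 1 / 2 ∧ |(n : ℝ) - 2 * (γ t).1| ≤ 2 := by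
  rcases h with h | ⟨-, h⟩
  · exact ⟨j, le_rfl, by linarith, abs_sub_two_mul_fst_le h⟩
  · exact ⟨j + 1 / 2, by linarith, le_rfl, abs_sub_two_mul_fst_le h⟩

/-- Neighbouring letters are at bounded distance. -/
lemma abs_sub_le_of_graphZInf_adj {a b : ℤ} (h : graphZInf.Adj a b) : |(a : ℝ) - b| ≤ 7 := by
  obtain ⟨γ, hγ, j, ha, hb⟩ := h
  obtain ⟨s, hs1, hs2, hs⟩ := ha.exists_time
  obtain ⟨t, ht1, ht2, ht⟩ := hb.exists_time
  push_cast at ht1 ht2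
  have hj : (0 : ℝ) ≤ j := j.cast_nonneg
  -- The times lie in `[j, j + 1/2]` and `[j + 1, j + 3/2]`, so they differ by at most `3/2`; the
  -- bound is `2 + 2 * (3/2) + 2 = 7`.
  have hst := abs_fst_sub_le_of_trajectory hγ.1 (hj.trans hs1) (by linarith : s ≤ t)
  rw [abs_le] at *
  constructor <;> linarith [hs.1, hs.2, ht.1, ht.2, hst.1, hst.2]

namespace MarkovShift

variable {H : ArcGraph}

/-! ### Letters, cylinders and diameters -/

@[simp] lemma letter_iterate_shift (x : MarkovShift H) (n i : ℕ) :
    (shift^[n] x).letter i = x.letter (n + i) := by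
  induction n generalizing x with
  | zero => simp
  | succ n ih =>
    rw [Function.iterate_succ_apply, ih]
    exact congrArg x.1 (by omega)

lemma adj_letter (x : MarkovShift H) (i : ℕ) : H.Adj (x.letter i) (x.letter (i + 1)) := x.2 i

lemma letter_mem_verts (x : MarkovShift H) (i : ℕ) : x.letter i ∈ H.verts :=
  H.left_mem (x.adj_letter i)

lemma abs_letter_add_sub_le {K : ℝ} (hK : ∀ a b, H.Adj a b → |(a : ℝ) - b| ≤ K)
    (x : MarkovShift H) (i k : ℕ) : |(x.letter i : ℝ) - x.letter (i + k)| ≤ K * k := by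
  induction k with
  | zero => simp
  | succ k ih =>
    have h1 := hK _ _ (x.adj_letter (i + k))
    have h2 := abs_sub_le (x.letter i : ℝ) (x.letter (i + k)) (x.letter (i + k + 1))
    rw [← add_assoc]
    push_cast
    linarith

lemma edist_eq_tsum (x y : MarkovShift H) :
    edist x y = ∑' i : ℕ, ENNReal.ofReal (|(x.letter i : ℝ) - y.letter i| / 2 ^ i) := rfl

lemma letter_eq_of_edist_lt_one {x y : MarkovShift H} (h : edist x y < 1) :
    x.letter 0 = y.letter 0 := by
  have h1 : ENNReal.ofReal (|(x.letter 0 : ℝ) - y.letter 0| / 2 ^ 0) < 1 :=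
    (ENNReal.le_tsum 0).trans_lt h
  rw [pow_zero, div_one, ENNReal.ofReal_lt_one] at h1
  have h2 : |x.letter 0 - y.letter 0| < 1 := by exact_mod_cast h1
  have := abs_lt.1 h2
  omega

/-- Cylinders of length `m + 1` have diameter at most a constant times `2 ^ (-m)`. -/
lemma exists_ediam_cylinder_le {K : ℝ} (hK : ∀ a b, H.Adj a b → |(a : ℝ) - b| ≤ K) :
    ∃ C : ℝ≥0∞, C ≠ ⊤ ∧ ∀ (m : ℕ) (w : Fin (m + 1) → ℤ),
      Metric.ediam (cylinder H w) ≤ C * 2⁻¹ ^ m := by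
  -- Two points of the cylinder agree at position `m` and then drift by at most `K` per step each,
  -- so they differ by at most `2 * K * k` at position `m + k`.
  have hsum : Summable fun k : ℕ => 2 * K * ((k : ℝ) ^ 1 * (1 / 2) ^ k) :=
    Summable.mul_left (2 * K)
      (summable_pow_mul_geometric_of_norm_lt_one (R := ℝ) 1 (r := 1 / 2) (by norm_num))
  refine ⟨∑' k : ℕ, ENNReal.ofReal (2 * K * ((k : ℝ) ^ 1 * (1 / 2) ^ k)),
    hsum.tsum_ofReal_ne_top, fun m w => Metric.ediam_le fun x hx y hy => ?_⟩
  have hxy : ∀ i < m + 1, x.letter i = y.letter i := fun i hi =>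
    (hx ⟨i, hi⟩).trans (hy ⟨i, hi⟩).symm
  rw [edist_eq_tsum, ← Summable.sum_add_tsum_nat_add' (k := m) ENNReal.summable,
    Finset.sum_eq_zero, zero_add, ← ENNReal.tsum_mul_right]
  · refine ENNReal.tsum_le_tsum fun k => ?_
    have h2 : (2⁻¹ : ℝ≥0∞) ^ m = ENNReal.ofReal ((1 / 2) ^ m) := by
      rw [ENNReal.ofReal_pow (by norm_num), one_div, ENNReal.ofReal_inv_of_pos (by norm_num)]
      simp
    rw [h2, ← ENNReal.ofReal_mul' (by positivity)]
    refine ENNReal.ofReal_le_ofReal ?_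
    have e1 := x.abs_letter_add_sub_le hK m k
    have e2 := y.abs_letter_add_sub_le hK m k
    rw [hxy m (by omega)] at e1
    have e3 := abs_sub_le (x.letter (m + k) : ℝ) (y.letter m) (y.letter (m + k))
    rw [abs_sub_comm] at e1
    have e4 : |(x.letter (m + k) : ℝ) - y.letter (m + k)| ≤ 2 * K * k := by linarith
    rw [add_comm k m, div_le_iff₀ (by positivity)]
    have e5 : 2 * K * ((k : ℝ) ^ 1 * (1 / 2) ^ k) * (1 / 2) ^ m * 2 ^ (m + k) = 2 * K * k := by
      rw [pow_add, one_div, inv_pow, inv_pow]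
      field_simp
    rwa [e5]
  · intro i hi
    rw [hxy i (by rw [Finset.mem_range] at hi; omega)]
    simp

/-! ### The covering argument -/

/-- The words counted by `zCount`. -/
def countedWords (H : ArcGraph) (e : ℤ → ℕ) (M q n : ℕ) : Set (Fin (n + 2) → ℤ) :=
  {w | (cylinder H w).Nonempty ∧ e (w 0) ≤ q ∧ e (w (Fin.last (n + 1))) ≤ q ∧
    ((Finset.univ.filter fun i => e (w i) ≤ q).card : ℝ) ≤ ((n : ℝ) + 2) / M}

lemma zCount_eq_encard (e : ℤ → ℕ) (M q n : ℕ) :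
    zCount H e M q n = (countedWords H e M q n).encard := rfl

lemma exists_ge_letter_eq_of_recurrent {x : MarkovShift H} (hx : x ∈ recurrentPoints H) (N : ℕ) :
    ∃ m ≥ N, x.letter m = x.letter 0 := by
  obtain ⟨n, hn, hlim⟩ := hx
  have h := hlim.eventually (Metric.eball_mem_nhds x one_pos)
  obtain ⟨j, hj, hjk⟩ := (h.and (eventually_ge_atTop N)).exists
  refine ⟨n j, hjk.trans (hn.id_le j), ?_⟩
  simpa using letter_eq_of_edist_lt_one hj

/-- Only finitely many vertices are small, so their frequencies, each tending to zero, also sum to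
zero in the limit. -/
lemma eventually_card_le_of_escape {e : ℤ → ℕ} {q : ℕ} (he : {a ∈ H.verts | e a ≤ q}.Finite)
    {x : MarkovShift H} (hx : x ∈ escapeOnAverage H) {M : ℕ} (hM : 1 ≤ M) :
    ∀ᶠ m : ℕ in atTop,
      (((Finset.range m).filter fun i => e (x.letter i) ≤ q).card : ℝ) ≤ (m : ℝ) / M := by
  have hlim : Tendsto (fun n : ℕ => ∑ a ∈ he.toFinset, (1 / (n : ℝ)) * ∑ i ∈ Finset.range n,
      (cylinder H ![a]).indicator (fun _ => (1 : ℝ)) (shift^[i] x)) atTop (𝓝 0) := by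
    simpa only [Finset.sum_const_zero] using
      tendsto_finsetSum he.toFinset fun a ha => hx a (he.mem_toFinset.1 ha).1
  have hM' : (0 : ℝ) < M := by exact_mod_cast hM
  filter_upwards [hlim.eventually_lt_const (one_div_pos.2 hM'), eventually_gt_atTop 0] with m hm hm0
  have hm0' : (0 : ℝ) < m := by exact_mod_cast hm0
  rw [← Finset.mul_sum, Finset.sum_comm, one_div, inv_mul_lt_iff₀ hm0', mul_one_div] at hm
  refine le_trans ?_ hm.le
  rw [Finset.card_filter]
  push_cast
  refine Finset.sum_le_sum fun i _ => ?_
  have hnn : ∀ a ∈ he.toFinset,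
      0 ≤ (cylinder H ![a]).indicator (fun _ => (1 : ℝ)) (shift^[i] x) :=
    fun a _ => indicator_nonneg (fun _ _ => zero_le_one) _
  split_ifs with h
  · refine le_trans ?_ (Finset.single_le_sum hnn
      (he.mem_toFinset.2 ⟨x.letter_mem_verts i, h⟩))
    rw [indicator_of_mem]
    intro j
    simp [Subsingleton.elim j 0]
  · exact Finset.sum_nonneg hnn

/-- The points of `E ∩ R` whose first letter has label at most `q`. -/
def escapingRecurrentFrom (H : ArcGraph) (e : ℤ → ℕ) (q : ℕ) : Set (MarkovShift H) :=
  {x | x ∈ escapeOnAverage H ∩ recurrentPoints H ∧ e (x.letter 0) ≤ q}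

lemma exists_mem_countedWords {e : ℤ → ℕ} {q : ℕ} (he : {a ∈ H.verts | e a ≤ q}.Finite)
    {M : ℕ} (hM : 1 ≤ M) {x : MarkovShift H} (hx : x ∈ escapingRecurrentFrom H e q) (N : ℕ) :
    ∃ n ≥ N, (fun i : Fin (n + 2) => x.letter i) ∈ countedWords H e M q n := by
  obtain ⟨⟨hE, hR⟩, hq⟩ := hx
  obtain ⟨k, hk⟩ := eventually_atTop.1 (eventually_card_le_of_escape he hE hM)
  obtain ⟨m, hm, hm0⟩ := exists_ge_letter_eq_of_recurrent hR (max k (N + 1))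
  obtain ⟨n, rfl⟩ : ∃ n, m = n + 1 := ⟨m - 1, by omega⟩
  refine ⟨n, by omega, ⟨x, fun _ => rfl⟩, by simpa using hq, by simpa [hm0] using hq, ?_⟩
  have := hk (n + 2) (by omega)
  rw [Finset.card_filter, Finset.sum_range, ← Finset.card_filter] at this
  exact_mod_cast this

lemma dimH_escapingRecurrentFrom_le {K : ℝ} (hK : ∀ a b, H.Adj a b → |(a : ℝ) - b| ≤ K)
    {e : ℤ → ℕ} {q : ℕ} (he : {a ∈ H.verts | e a ≤ q}.Finite) {M : ℕ} (hM : 1 ≤ M) {s : NNReal}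
    (hs : hInfMq H e M q < ((s * Real.log 2 : ℝ) : EReal)) :
    dimH (escapingRecurrentFrom H e q) ≤ s := by
  obtain ⟨C, hC, hdiam⟩ := exists_ediam_cylinder_le hK
  obtain ⟨t, ht1, ht2⟩ := EReal.lt_iff_exists_real_btwn.1 hs
  have hts : t < s * Real.log 2 := by exact_mod_cast ht2
  -- Ratio of the geometric series dominating the covering sum: at most `exp (t n)` words, each
  -- contributing at most `C ^ s * 2 ^ (-s n)`.
  set ρ : ℝ := Real.exp t * (1 / 2) ^ (s : ℝ) with hρ
  have hρ0 : 0 ≤ ρ := by positivity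
  have hρ1 : ρ < 1 := by
    rw [hρ, Real.rpow_def_of_pos (by norm_num), ← Real.exp_add, Real.exp_lt_one_iff, one_div,
      Real.log_inv]
    linarith
  have hz : ∀ᶠ n : ℕ in atTop,
      (zCount H e M q n : ℝ≥0∞) ≤ ENNReal.ofReal (Real.exp t) ^ n := by
    filter_upwards [eventually_lt_of_limsup_lt ht1, eventually_gt_atTop 0] with n hn hn0
    have hn0' : (0 : EReal) < n := by exact_mod_cast hn0
    rw [EReal.div_lt_iff hn0' (EReal.natCast_ne_top n)] at hn
    have hexp : (t : EReal) * n = ENNReal.log (ENNReal.ofReal (Real.exp t) ^ n) := by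
      rw [ENNReal.log_pow, ENNReal.log_ofReal_of_pos (Real.exp_pos t), Real.log_exp, mul_comm]
    rw [hexp, ENNReal.log_lt_log_iff] at hn
    exact hn.le
  obtain ⟨N₀, hN₀⟩ := eventually_atTop.1 hz
  borelize (MarkovShift H)
  refine dimH_le_of_hausdorffMeasure_ne_top (ne_top_of_le_ne_top (b := C ^ (s : ℝ) *
    (1 - ENNReal.ofReal ρ)⁻¹) ?_ ?_)
  · refine ENNReal.mul_ne_top (ENNReal.rpow_ne_top_of_nonneg s.2 hC) (ENNReal.inv_ne_top.2 ?_)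
    exact (tsub_pos_of_lt (by simpa using hρ1)).ne'
  let T : ∀ N : ℕ, (Σ k : ℕ, countedWords H e M q (N + k)) → Set (MarkovShift H) :=
    fun N p => cylinder H p.2.1
  refine (MeasureTheory.Measure.hausdorffMeasure_le_liminf_tsum (s : ℝ) _ (l := atTop)
    (fun N : ℕ => C * 2⁻¹ ^ N) ?_ T ?_ ?_).trans ?_
  · have := ENNReal.Tendsto.const_mul (a := C)
      (ENNReal.tendsto_pow_atTop_nhds_zero_of_lt_one (r := 2⁻¹) (by simp)) (.inr hC)
    simpa using this
  · refine .of_forall fun N p => (hdiam _ p.2.1).trans ?_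
    gcongr C * ?_
    exact pow_le_pow_of_le_one (by simp) (by simp) (by omega)
  · refine .of_forall fun N x hx => ?_
    obtain ⟨n, hn, hw⟩ := exists_mem_countedWords he hM hx N
    obtain ⟨k, rfl⟩ := Nat.exists_eq_add_of_le hn
    exact mem_iUnion.2 ⟨⟨k, ⟨_, hw⟩⟩, fun _ => rfl⟩
  · refine liminf_le_of_frequently_le' (Eventually.frequently ?_)
    filter_upwards [eventually_ge_atTop N₀] with N hN
    rw [ENNReal.tsum_sigma', ← ENNReal.tsum_geometric, ← ENNReal.tsum_mul_left]
    refine ENNReal.tsum_le_tsum fun k => ?_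
    have h1 : ∀ w : countedWords H e M q (N + k),
        Metric.ediam (T N ⟨k, w⟩) ^ (s : ℝ) ≤ (C * 2⁻¹ ^ (N + k)) ^ (s : ℝ) := by
      intro w
      refine ENNReal.rpow_le_rpow ((hdiam _ w.1).trans ?_) s.2
      gcongr C * ?_
      exact pow_le_pow_of_le_one (by simp) (by simp) (by omega)
    have h2 : (C * 2⁻¹ ^ (N + k)) ^ (s : ℝ) =
        C ^ (s : ℝ) * ENNReal.ofReal ((1 / 2) ^ (s : ℝ)) ^ (N + k) := by
      rw [ENNReal.mul_rpow_of_nonneg _ _ s.coe_nonneg, ← ENNReal.rpow_natCast,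
        ← ENNReal.rpow_natCast, ← ENNReal.rpow_mul, mul_comm (_ : ℝ) (s : ℝ), ENNReal.rpow_mul,
        ← ENNReal.ofReal_rpow_of_pos (by norm_num), one_div,
        ENNReal.ofReal_inv_of_pos (by norm_num)]
      simp
    refine (ENNReal.tsum_le_tsum h1).trans ?_
    rw [ENNReal.tsum_set_const, ← zCount_eq_encard, h2]
    refine (mul_le_mul_left (hN₀ (N + k) (by omega)) _).trans ?_
    rw [mul_left_comm, ← mul_pow, ← ENNReal.ofReal_mul (Real.exp_pos t).le, ← hρ]
    gcongr C ^ (s : ℝ) * ?_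
    -- Discarding `ρ ^ N ≤ 1` makes the bound independent of `N`.
    exact pow_le_pow_of_le_one (by simp) (by simpa using hρ1.le) (by omega)

/-! ### Non-negativity of the entropy at infinity -/

/-- Prepend a letter. -/
def cons (a : ℤ) (y : MarkovShift H) (h : H.Adj a (y.letter 0)) : MarkovShift H :=
  ⟨fun i => Nat.casesOn i a y.letter, fun i => by cases i; exacts [h, y.2 _]⟩

lemma exists_prepend {a b : ℤ} (h : Relation.TransGen H.Adj a b) (y : MarkovShift H)
    (hy : y.letter 0 = b) :
    ∃ (x : MarkovShift H) (n : ℕ), x.letter 0 = a ∧ ∀ i, x.letter (n + i) = y.letter i := by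
  subst hy
  induction h using Relation.TransGen.head_induction_on with
  | single h => exact ⟨cons _ y h, 1, rfl, fun i => by rw [add_comm]; rfl⟩
  | head h' h ih =>
    obtain ⟨x, n, rfl, hx⟩ := ih
    exact ⟨cons _ x h', n + 1, rfl, fun i => by rw [← hx i, add_right_comm]; rfl⟩

/-- Every vertex lies on a closed path, hence has a successor; iterating a choice of successors
gives the point. -/
lemma exists_letter_zero_eq (htrans : H.IsTransitive) {a : ℤ} (ha : a ∈ H.verts) :
    ∃ x : MarkovShift H, x.letter 0 = a := by
  have hsucc : ∀ b : H.verts, ∃ c : H.verts, H.Adj b c := by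
    intro b
    obtain ⟨c, hc, -⟩ := Relation.TransGen.head'_iff.1 (htrans b b.2 b b.2)
    exact ⟨⟨c, H.right_mem hc⟩, hc⟩
  choose f hf using hsucc
  refine ⟨⟨fun i => (f^[i] ⟨a, ha⟩ : H.verts), fun i => ?_⟩, rfl⟩
  simp only [Function.iterate_succ_apply']
  exact hf _

lemma exists_excursion (htrans : H.IsTransitive) {a b : ℤ} (ha : a ∈ H.verts) (hb : b ∈ H.verts) :
    ∃ (x : MarkovShift H) (k l : ℕ), x.letter 0 = a ∧ x.letter k = b ∧ k ≤ l ∧ x.letter l = a := by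
  obtain ⟨z, hz⟩ := exists_letter_zero_eq htrans ha
  obtain ⟨y, l, hy, hyz⟩ := exists_prepend (htrans b hb a ha) z hz
  obtain ⟨x, k, hx, hxy⟩ := exists_prepend (htrans a ha b hb) y hy
  refine ⟨x, k, k + l, hx, (hxy 0).trans hy, by omega, ?_⟩
  rw [hxy, ← add_zero l, hyz, hz]

lemma exists_far_vertex (hinf : H.verts.Infinite) {F : Set ℤ} (hF : F.Finite) (R : ℝ) :
    ∃ b ∈ H.verts, ∀ c ∈ F, R < |(c : ℝ) - b| := by
  have hfin : (⋃ c ∈ F, {b : ℤ | |(c : ℝ) - b| ≤ R}).Finite := by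
    refine hF.biUnion fun c _ => (Set.finite_Icc ⌊c - R⌋ ⌈c + R⌉).subset fun b hb => ?_
    have hb := abs_le.1 (mem_ofPred.1 hb)
    refine ⟨?_, ?_⟩
    · have h : ((⌊c - R⌋ : ℤ) : ℝ) ≤ b := (Int.floor_le _).trans (by linarith)
      exact_mod_cast h
    · have h : (b : ℝ) ≤ ⌈(c : ℝ) + R⌉ := le_trans (by linarith) (Int.le_ceil _)
      exact_mod_cast h
  obtain ⟨b, hb, hbF⟩ := (hinf.sdiff hfin).nonempty
  refine ⟨b, hb, fun c hc => ?_⟩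
  by_contra! h
  exact hbF (mem_biUnion hc h)

/-- Travel from `a` to a vertex far from all small ones and back, then cut the path at the last
small letter before the far vertex and the first one after it. Bounded jumps make this piece long,
and only its two ends are small. -/
lemma exists_countedWords_nonempty {K : ℝ} (hK : ∀ a b, H.Adj a b → |(a : ℝ) - b| ≤ K)
    (hinf : H.verts.Infinite) (htrans : H.IsTransitive) {e : ℤ → ℕ} {q : ℕ}
    (he : {a ∈ H.verts | e a ≤ q}.Finite) {a : ℤ} (ha : a ∈ H.verts) (haq : e a ≤ q)
    {M : ℕ} (hM : 1 ≤ M) (N : ℕ) : ∃ n ≥ N, (countedWords H e M q n).Nonempty := by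
  -- Large enough for both `N ≤ n` and `2 * M ≤ n + 2`; the latter lets two small letters pass the
  -- frequency test.
  set L : ℕ := N + 2 * M + 1
  obtain ⟨b, hb, hfar⟩ := exists_far_vertex hinf he (K * L)
  obtain ⟨x, k, l, hx0, hxk, hkl, hxl⟩ := exists_excursion htrans ha hb
  have hK0 : 0 ≤ K := (abs_nonneg _).trans (hK _ _ (x.adj_letter 0))
  let P : ℕ → Prop := fun i => e (x.letter i) ≤ q
  have hP0 : P 0 := by simpa [P, hx0] using haq
  have hex : ∃ j, k ≤ j ∧ P j := ⟨l, hkl, by simpa [P, hxl] using haq⟩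
  obtain ⟨i, hik, hPi, himax⟩ : ∃ i ≤ k, P i ∧ ∀ r, i < r → r ≤ k → ¬ P r := by
    classical
    exact ⟨Nat.findGreatest P k, Nat.findGreatest_le k,
      Nat.findGreatest_spec k.zero_le hP0, fun r h1 h2 => Nat.findGreatest_is_greatest h1 h2⟩
  obtain ⟨j, hkj, hPj, hjmin⟩ : ∃ j ≥ k, P j ∧ ∀ r, k ≤ r → r < j → ¬ P r := by
    classical
    exact ⟨Nat.find hex, (Nat.find_spec hex).1, (Nat.find_spec hex).2,
      fun r h1 h2 h3 => Nat.find_min hex h2 ⟨h1, h3⟩⟩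
  have hlen : L < k - i := by
    have h1 := hfar _ ⟨x.letter_mem_verts i, hPi⟩
    have h2 := x.abs_letter_add_sub_le hK i (k - i)
    rw [Nat.add_sub_cancel' hik, hxk] at h2
    have h3 : (L : ℝ) < (k - i : ℕ) := lt_of_mul_lt_mul_left (h1.trans_le h2) hK0
    exact_mod_cast h3
  obtain ⟨n, hn⟩ : ∃ n, j = i + (n + 1) := ⟨j - i - 1, by omega⟩
  refine ⟨n, by omega, fun r => x.letter (i + r), ⟨shift^[i] x, fun r => by simp⟩, ?_, ?_, ?_⟩
  · simpa using hPi
  · simpa [← hn] using hPj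
  · have hsub : (Finset.univ.filter fun r : Fin (n + 2) => e (x.letter (i + r)) ≤ q) ⊆
        {0, Fin.last (n + 1)} := by
      intro r hr
      have hr : P (i + r) := (Finset.mem_filter.1 hr).2
      rw [Finset.mem_insert, Finset.mem_singleton, Fin.ext_iff, Fin.ext_iff, Fin.val_last,
        Fin.val_zero]
      by_contra! hc
      rcases le_total (i + r : ℕ) k with h | h
      · exact himax _ (by omega) h hr
      · exact hjmin _ h (by have := r.2; omega) hr
    have hcard := (Finset.card_le_card hsub).trans Finset.card_le_two
    have hM' : (0 : ℝ) < M := by exact_mod_cast hM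
    rw [le_div_iff₀ hM']
    have h1 : 2 * M ≤ n + 2 := by omega
    refine le_trans (mul_le_mul_of_nonneg_right (Nat.cast_le.2 hcard) hM'.le) ?_
    exact_mod_cast h1

/-- Excludes the value `-∞`, for which the dimension bound would fail even for an empty set. -/
lemma hInfMq_nonneg {K : ℝ} (hK : ∀ a b, H.Adj a b → |(a : ℝ) - b| ≤ K)
    (hinf : H.verts.Infinite) (htrans : H.IsTransitive) {e : ℤ → ℕ} {q : ℕ}
    (he : {a ∈ H.verts | e a ≤ q}.Finite) {a : ℤ} (ha : a ∈ H.verts) (haq : e a ≤ q)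
    {M : ℕ} (hM : 1 ≤ M) : 0 ≤ hInfMq H e M q := by
  refine le_limsup_of_frequently_le (frequently_atTop.2 fun N => ?_)
  obtain ⟨n, hn, hne⟩ := exists_countedWords_nonempty hK hinf htrans he ha haq hM N
  refine ⟨n, hn, EReal.div_nonneg (ENNReal.zero_le_log_iff.2 ?_) (by positivity)⟩
  rw [zCount_eq_encard]
  exact_mod_cast one_le_encard_iff_nonempty.2 hne

/-! ### The dimension bound -/

lemma dimH_escapingRecurrentFrom_le_div {K : ℝ} (hK : ∀ a b, H.Adj a b → |(a : ℝ) - b| ≤ K)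
    {e : ℤ → ℕ} {q : ℕ} (he : {a ∈ H.verts | e a ≤ q}.Finite) {M : ℕ} (hM : 1 ≤ M)
    (h0 : 0 ≤ hInfMq H e M q) :
    ((dimH (escapingRecurrentFrom H e q) : ℝ≥0∞) : EReal) ≤
      hInfMq H e M q / ((Real.log 2 : ℝ) : EReal) := by
  have hlog : (0 : EReal) < ((Real.log 2 : ℝ) : EReal) := by
    exact_mod_cast Real.log_pos one_lt_two
  by_contra! hlt
  obtain ⟨r, hr1, hr2⟩ := EReal.lt_iff_exists_real_btwn.1 hlt
  have hr0 : 0 ≤ r := by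
    exact_mod_cast (EReal.div_nonneg h0 hlog.le).trans hr1.le
  rw [EReal.div_lt_iff hlog (EReal.coe_ne_top _)] at hr1
  have h := dimH_escapingRecurrentFrom_le hK he hM (s := ⟨r, hr0⟩) (by exact_mod_cast hr1)
  have h' : ((dimH (escapingRecurrentFrom H e q) : ℝ≥0∞) : EReal) ≤ (r : EReal) := by
    exact EReal.coe_ennreal_le_coe_ennreal_iff.2 h
  exact absurd hr2 (not_lt.2 h')

lemma dimH_escapingRecurrentFrom_le_hInf_div {K : ℝ}
    (hK : ∀ a b, H.Adj a b → |(a : ℝ) - b| ≤ K)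
    (hinf : H.verts.Infinite) (htrans : H.IsTransitive) {e : ℤ → ℕ}
    (he : ∀ q : ℕ, {a ∈ H.verts | e a ≤ q}.Finite) (p : ℕ) :
    ((dimH (escapingRecurrentFrom H e p) : ℝ≥0∞) : EReal) ≤
      hInf H e / ((Real.log 2 : ℝ) : EReal) := by
  have hlog : ((Real.log 2 : ℝ) : EReal) > 0 := by
    exact_mod_cast Real.log_pos one_lt_two
  obtain ⟨a, ha⟩ := hinf.nonempty
  rw [EReal.le_div_iff_mul_le hlog (EReal.coe_ne_top _)]
  refine le_liminf_of_le (h := ?_)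
  -- `e a ≤ q` provides the small vertex from which excursions start.
  filter_upwards [eventually_ge_atTop p, eventually_ge_atTop (e a)] with q hpq haq
  refine le_liminf_of_le (h := ?_)
  filter_upwards [eventually_ge_atTop 1] with M hM
  rw [← EReal.le_div_iff_mul_le hlog (EReal.coe_ne_top _)]
  refine le_trans ?_ (dimH_escapingRecurrentFrom_le_div hK (he q) hM
    (hInfMq_nonneg hK hinf htrans (he q) ha haq hM))
  exact EReal.coe_ennreal_le_coe_ennreal_iff.2 (dimH_mono fun x hx => ⟨hx.1, hx.2.trans hpq⟩)

end MarkovShift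

theorem mainTheorem7 (H : ArcGraph) (hH : H.IsSubgraph graphZInf) (hinf : H.verts.Infinite)
    (htrans : H.IsTransitive) (e : ℤ → ℕ) (he : ∀ q : ℕ, {a ∈ H.verts | e a ≤ q}.Finite)
    (hfin : MarkovShift.hInf H e < ⊤) :
    ((dimH (MarkovShift.escapeOnAverage H ∩ MarkovShift.recurrentPoints H) : ℝ≥0∞) : EReal) ≤
      MarkovShift.hInf H e / ((Real.log 2 : ℝ) : EReal) := by
  have hK : ∀ a b, H.Adj a b → |(a : ℝ) - b| ≤ 7 :=
    fun a b h => abs_sub_le_of_graphZInf_adj (hH.2 a b h)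
  have hbound := MarkovShift.dimH_escapingRecurrentFrom_le_hInf_div hK hinf htrans he
  have hunion : MarkovShift.escapeOnAverage H ∩ MarkovShift.recurrentPoints H =
      ⋃ q, MarkovShift.escapingRecurrentFrom H e q := by
    ext x
    rw [mem_iUnion]
    exact ⟨fun hx => ⟨e (x.letter 0), hx, le_rfl⟩, fun ⟨_, hx⟩ => hx.1⟩
  -- Nonnegativity of the bound allows the supremum over `q` to be compared in `ℝ≥0∞`.
  have h0 := (EReal.coe_ennreal_nonneg _).trans (hbound 0)
  rw [hunion, dimH_iUnion, ← EReal.coe_toENNReal h0, EReal.coe_ennreal_le_coe_ennreal_iff]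
  refine iSup_le fun q => ?_
  rw [← EReal.coe_ennreal_le_coe_ennreal_iff, EReal.coe_toENNReal h0]
  exact hbound q
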